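/- Let $M$ be a smooth manifold of dimension $n\ge 2$, let $\epsilon>0$ and $0<\epsilon_0\le\sqrt{2\epsilon}$, and let $\mathrm{g}_\rho$, $\rho\in(-\epsilon,\epsilon)$, be a smooth one-parameter family of Riemannian (or, more generally, pseudo-Riemannian) metrics on $M$. On $\mathring X=M\times(0,\epsilon_0)_r$ consider the metric $$g_+=\frac{dr^2+g_r}{r^2},\qquad g_r=\mathrm{g}_{-r^2/2},$$ and on $\widetilde{\mathcal G}=\mathbb R_+\times M\times(-\epsilon,\epsilon)$, with points $(t,p,\rho)$, the metric $$\widetilde g=2\rho\,dt^2+2t\,dt\,d\rho+t^2\,\mathrm{g}_\rho .$$ (In the coordinates $r=\sqrt{-2\rho}$, $s=rt$ on $\{\rho<0\}$ one has $\widetilde g=s^2g_+-ds^2$. The pairs consisting of an even Poincaré metric in normal form and the corresponding straight ambient metric in normal form are of this type.) Let $Y\subset\mathring X$ be a smooth embedded submanifold with $1\le\dim Y\le n$, and let its homogeneous lift be $$\overline Y=\{(t,p,\rho)\in\widetilde{\mathcal G}:\ \rho<0,\ (p,\sqrt{-2\rho})\in Y\}\cong\mathbb R_+\times Y,$$ which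 is invariant under the dilations $(t,p,\rho)\mapsto(\lambda t,p,\rho)$, $\lambda>0$. Then $Y$ is minimal with respect to $g_+$ if and only if $\overline Y$ is minimal with respect to $\widetilde g$. Here a submanifold of a pseudo-Riemannian manifold is called minimal if the induced metric is everywhere nondegenerate (automatic for $Y$ if the $\mathrm{g}_\rho$ are Riemannian) and its mean curvature vector (the trace of the second fundamental form, with respect to the induced metric, divided by the dimension) vanishes identically. -/

import Mathlib

open Set
open scoped Manifold ContDiff

noncomputable section

/-! ### Linear algebra of a nondegenerate bilinear form -/

section LinearAlgebra

variable {V : Type*} [AddCommGroup V] [Module ℝ V] [FiniteDimensional ℝ V]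

open Classical in
/-- Raising an index: the vector `v` with `B v w = α w` for all `w`, for a nondegenerate form `B`
(and `0` if `B` is degenerate). -/
def sharp (B : LinearMap.BilinForm ℝ V) (α : Module.Dual ℝ V) : V :=
  if hB : B.Nondegenerate then (B.toDual hB).symm α else 0

/-- The trace `B^{ij} L_{ij}` of a vector valued bilinear map `L` with respect to a nondegenerate
form `B`; the vector `sharp B (b^i)` is `B^{ij} b_j`. -/
def metricTrace {W : Type*} [AddCommGroup W] [Module ℝ W]
    (B : LinearMap.BilinForm ℝ V) (L : V → V → W) : W :=
  ∑ i, L (Module.finBasis ℝ V i) (sharp B ((Module.finBasis ℝ V).coord i))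

end LinearAlgebra

/-! ### Submanifolds of pseudo-Riemannian manifolds

All manifolds here are without boundary. A tangent vector at `x` is written, as everywhere in
Mathlib, by its components in the coordinates of the preferred chart `extChartAt I x`. -/

section Geometry

variable {E : Type*} [NormedAddCommGroup E] [NormedSpace ℝ E]
  {H : Type*} [TopologicalSpace H]
  {N : Type*} [TopologicalSpace N]

/-- Fields of bilinear forms on the tangent spaces of `N`. -/
abbrev BilinField (I : ModelWithCorners ℝ E H) (N : Type*) [TopologicalSpace N]
    [ChartedSpace H N] : Type _ :=
  ∀ x : N, TangentSpace I x →L[ℝ] TangentSpace I x →L[ℝ] ℝ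

variable (I : ModelWithCorners ℝ E H) [ChartedSpace H N]

/-- The component functions `z ↦ g_{ij}(z)` of `g` in the chart `extChartAt I x`, as a function
with values in bilinear forms on the model space. -/
def metricInChart (g : BilinField I N) (x : N) (z : E) : E →L[ℝ] E →L[ℝ] ℝ :=
  let D : E →L[ℝ] E := mfderiv 𝓘(ℝ, E) I (extChartAt I x).symm z
  let G : E →L[ℝ] E →L[ℝ] ℝ := g ((extChartAt I x).symm z)
  G.bilinearComp D D

/-- The bilinear form `g x`. -/
def formAt (g : BilinField I N) (x : N) : LinearMap.BilinForm ℝ E :=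
  ContinuousLinearMap.toBilinForm (show E →L[ℝ] E →L[ℝ] ℝ from g x)

variable [FiniteDimensional ℝ E]

/-- The Christoffel symbols at `x` of the Levi-Civita connection of `g`, in the chart
`extChartAt I x`: `Γ(u, v)` is the vector with
`g (Γ(u, v), w) = 1/2 (∂_u g (v, w) + ∂_v g (u, w) - ∂_w g (u, v))`. -/
def christoffel (g : BilinField I N) (x : N) (u v : E) : E :=
  let dg : E →L[ℝ] (E →L[ℝ] E →L[ℝ] ℝ) := fderiv ℝ (metricInChart I g x) (extChartAt I x x)
  let dguv : E →L[ℝ] ℝ :=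
    (ContinuousLinearMap.apply ℝ ℝ v).comp ((ContinuousLinearMap.apply ℝ (E →L[ℝ] ℝ) u).comp dg)
  sharp (formAt I g x)
    ((2⁻¹ : ℝ) • ((dg u v : E →ₗ[ℝ] ℝ) + (dg v u : E →ₗ[ℝ] ℝ) - (dguv : E →ₗ[ℝ] ℝ)))

variable {E' : Type*} [NormedAddCommGroup E'] [NormedSpace ℝ E'] [FiniteDimensional ℝ E']
  {H' : Type*} [TopologicalSpace H'] (J : ModelWithCorners ℝ E' H')
  {S : Type*} [TopologicalSpace S] [ChartedSpace H' S]

/-- The differential of `f : S → N` at `q`. -/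
def differential (f : S → N) (q : S) : E' →L[ℝ] E := mfderiv J I f q

/-- The form induced by `g` on the tangent space of `S` at `q` by a map `f : S → N`, i.e. the
value of `f^* g` at `q`. -/
def inducedForm (g : BilinField I N) (f : S → N) (q : S) : LinearMap.BilinForm ℝ E' :=
  (formAt I g (f q)).compl₁₂ (differential I J f q : E' →ₗ[ℝ] E)
    (differential I J f q : E' →ₗ[ℝ] E)

/-- The component of `w` orthogonal to the image of the differential of `f` at `q`. -/
def normalPart (g : BilinField I N) (f : S → N) (q : S) (w : E) : E :=
  w - differential I J f q (sharp (inducedForm I J g f q)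
    ((formAt I g (f q) w).comp (differential I J f q : E' →ₗ[ℝ] E)))

/-- The covariant derivative `∇_a (df(b))` at `q` for the Levi-Civita connection of `g`, for
coordinate vector fields `a`, `b` of the chart of `S` at `q`:
`∂_a ∂_b f + Γ (∂_a f, ∂_b f)`. -/
def covariantHessian (g : BilinField I N) (f : S → N) (q : S) (a b : E') : E :=
  fderiv ℝ (fderiv ℝ (writtenInExtChartAt J I q f)) (extChartAt J q q) a b +
    christoffel I g (f q) (differential I J f q a) (differential I J f q b)

/-- The second fundamental form `L(a, b) = (∇_a b)^⊥`. -/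
def secondFundamentalForm (g : BilinField I N) (f : S → N) (q : S) (a b : E') : E :=
  normalPart I J g f q (covariantHessian I J g f q a b)

/-- The mean curvature vector `H = (1 / k) tr L`, where `k` is the dimension of `S` and the trace
is taken with respect to the induced metric. -/
def meanCurvature (g : BilinField I N) (f : S → N) (q : S) : E :=
  (Module.finrank ℝ E' : ℝ)⁻¹ •
    metricTrace (inducedForm I J g f q) (secondFundamentalForm I J g f q)

/-- The submanifold `f : S → N` is minimal with respect to `g`: it is nondegenerate, i.e. the
induced metric is nondegenerate at every point (automatic for an immersed submanifold if `g` is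
positive definite), and its mean curvature vector vanishes. -/
def IsMinimal (g : BilinField I N) (f : S → N) : Prop :=
  (∀ q, (inducedForm I J g f q).Nondegenerate) ∧ ∀ q, meanCurvature I J g f q = 0

/-- `γ ρ`, for `ρ ∈ (-ε, ε)`, is a smooth one-parameter family of pseudo-Riemannian metrics. The
values of `γ` at other parameters are irrelevant. -/
structure IsSmoothMetricFamily [IsManifold I 1 N] (ε : ℝ) (γ : ℝ → BilinField I N) : Prop where
  symm : ∀ ρ ∈ Ioo (-ε) ε, ∀ p, ∀ u v : TangentSpace I p, γ ρ p u v = γ ρ p v u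
  nondegenerate : ∀ ρ ∈ Ioo (-ε) ε, ∀ p, (formAt I (γ ρ) p).Nondegenerate
  smooth : ContMDiffOn (I.prod 𝓘(ℝ, ℝ)) (I.prod 𝓘(ℝ, E →L[ℝ] E →L[ℝ] ℝ)) ∞
    (fun x : N × ℝ ↦ Bundle.TotalSpace.mk' (E →L[ℝ] E →L[ℝ] ℝ)
      (E := fun p : N ↦ (TangentSpace I p →L[ℝ] TangentSpace I p →L[ℝ] ℝ)) x.1 (γ x.2 x.1))
    (univ ×ˢ Ioo (-ε) ε)

end Geometry

/-! ### Poincaré metric, ambient metric and homogeneous lift -/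

section Ambient

/-- The open interval `(a, b)` as an open subset of the line. -/
def openInterval (a b : ℝ) : TopologicalSpace.Opens ℝ := ⟨Ioo a b, isOpen_Ioo⟩

/-- The half-line `(0, ∞)` as an open subset of the line. -/
def posHalfLine : TopologicalSpace.Opens ℝ := ⟨Ioi 0, isOpen_Ioi⟩

/-- The interior `M × (0, ε₀)`, with points `(p, r)`. -/
abbrev PoincareSpace (M : Type*) (ε₀ : ℝ) : Type _ := M × openInterval 0 ε₀

/-- The ambient space `ℝ₊ × M × (-ε, ε)`, with points `(t, p, ρ)`. -/
abbrev AmbientSpace (M : Type*) (ε : ℝ) : Type _ := posHalfLine × M × openInterval (-ε) ε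

variable {E : Type*} [NormedAddCommGroup E] [NormedSpace ℝ E]
  {H : Type*} [TopologicalSpace H] (I : ModelWithCorners ℝ E H)
  {M : Type*} [TopologicalSpace M] [ChartedSpace H M]

/-- The metric `g₊ = r⁻² (dr² + g_r)` on `M × (0, ε₀)`, where `g_r = γ_{-r²/2}`. -/
def poincareMetric (ε₀ : ℝ) (γ : ℝ → BilinField I M) :
    BilinField (I.prod 𝓘(ℝ, ℝ)) (PoincareSpace M ε₀) := fun x ↦
  let r : ℝ := x.2
  let gr : E →L[ℝ] E →L[ℝ] ℝ := γ (-r ^ 2 / 2) x.1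
  let dr : E × ℝ →L[ℝ] ℝ := ContinuousLinearMap.snd ℝ E ℝ
  let pr : E × ℝ →L[ℝ] E := ContinuousLinearMap.fst ℝ E ℝ
  show E × ℝ →L[ℝ] E × ℝ →L[ℝ] ℝ from
    (r ^ 2)⁻¹ • ((ContinuousLinearMap.mul ℝ ℝ).bilinearComp dr dr + gr.bilinearComp pr pr)

/-- The metric `g̃ = 2ρ dt² + 2t dt dρ + t² γ_ρ` on `ℝ₊ × M × (-ε, ε)`. -/
def ambientMetric (ε : ℝ) (γ : ℝ → BilinField I M) :
    BilinField (𝓘(ℝ, ℝ).prod (I.prod 𝓘(ℝ, ℝ))) (AmbientSpace M ε) := fun x ↦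
  let t : ℝ := x.1
  let ρ : ℝ := x.2.2
  let gρ : E →L[ℝ] E →L[ℝ] ℝ := γ ρ x.2.1
  let dt : ℝ × E × ℝ →L[ℝ] ℝ := ContinuousLinearMap.fst ℝ ℝ (E × ℝ)
  let dρ : ℝ × E × ℝ →L[ℝ] ℝ :=
    (ContinuousLinearMap.snd ℝ E ℝ).comp (ContinuousLinearMap.snd ℝ ℝ (E × ℝ))
  let pr : ℝ × E × ℝ →L[ℝ] E :=
    (ContinuousLinearMap.fst ℝ E ℝ).comp (ContinuousLinearMap.snd ℝ ℝ (E × ℝ))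
  let m := ContinuousLinearMap.mul ℝ ℝ
  show ℝ × E × ℝ →L[ℝ] ℝ × E × ℝ →L[ℝ] ℝ from
    (2 * ρ) • m.bilinearComp dt dt + t • (m.bilinearComp dt dρ + m.bilinearComp dρ dt) +
      t ^ 2 • gρ.bilinearComp pr pr

lemma poincareMetric_apply (ε₀ : ℝ) (γ : ℝ → BilinField I M) (p : M) (r : openInterval 0 ε₀)
    (u v : E) (a b : ℝ) :
    (show E × ℝ →L[ℝ] E × ℝ →L[ℝ] ℝ from poincareMetric I ε₀ γ (p, r)) (u, a) (v, b) =
      ((r : ℝ) ^ 2)⁻¹ *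
        (a * b + (show E →L[ℝ] E →L[ℝ] ℝ from γ (-(r : ℝ) ^ 2 / 2) p) u v) := rfl

lemma ambientMetric_apply (ε : ℝ) (γ : ℝ → BilinField I M) (t : posHalfLine) (p : M)
    (ρ : openInterval (-ε) ε) (u v : E) (a b c d : ℝ) :
    (show ℝ × E × ℝ →L[ℝ] ℝ × E × ℝ →L[ℝ] ℝ from ambientMetric I ε γ (t, p, ρ))
        (a, u, c) (b, v, d) =
      2 * (ρ : ℝ) * (a * b) + (t : ℝ) * (a * d + c * b) +
        (t : ℝ) ^ 2 * (show E →L[ℝ] E →L[ℝ] ℝ from γ (ρ : ℝ) p) u v := rfl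

end Ambient

section Lift

variable {M : Type*}

lemma neg_sq_div_two_mem {ε₀ ε r : ℝ} (h : ε₀ ^ 2 ≤ 2 * ε) (hr : r ∈ openInterval 0 ε₀) :
    -r ^ 2 / 2 ∈ openInterval (-ε) ε := by
  obtain ⟨h0, h1⟩ : 0 < r ∧ r < ε₀ := hr
  constructor <;> nlinarith [sq_nonneg r, mul_pos h0 h0]

/-- The projection `(t, p, ρ) ↦ (p, √(-2ρ))`, which is meaningful where `ρ ≤ 0`. -/
def projX {ε : ℝ} (x : AmbientSpace M ε) : M × ℝ := (x.2.1, Real.sqrt (-2 * (x.2.2 : ℝ)))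

/-- The homogeneous lift of a submanifold `f : S → M × (0, ε₀)`, i.e. its inverse image under
`(t, p, ρ) ↦ (p, √(-2ρ))`, parametrized as `ℝ₊ × S`: the point `(t, q)` is sent to
`(t, p, -r² / 2)` with `(p, r) = f q`. -/
def homogeneousLift {S : Type*} {ε₀ ε : ℝ} (h : ε₀ ^ 2 ≤ 2 * ε) (f : S → PoincareSpace M ε₀) :
    posHalfLine × S → AmbientSpace M ε := fun y ↦
  (y.1, (f y.2).1, ⟨-((f y.2).2 : ℝ) ^ 2 / 2, neg_sq_div_two_mem h (f y.2).2.2⟩)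

/-- The image of the homogeneous lift is the inverse image of the submanifold under the
projection `(t, p, ρ) ↦ (p, √(-2ρ))`. -/
lemma range_homogeneousLift {S : Type*} {ε₀ ε : ℝ} (h : ε₀ ^ 2 ≤ 2 * ε)
    (f : S → PoincareSpace M ε₀) :
    range (homogeneousLift h f) = projX ⁻¹' range (fun q ↦ ((f q).1, ((f q).2 : ℝ))) := by
  ext ⟨t, p, ρ, hρ⟩
  simp only [mem_range, mem_preimage, projX, homogeneousLift, Prod.exists, Prod.mk.injEq,
    Subtype.mk.injEq]
  constructor
  · rintro ⟨t', q, -, h1, h2⟩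
    refine ⟨q, h1, ?_⟩
    have h0 : 0 < ((f q).2 : ℝ) := (f q).2.2.1
    rw [← h2, show -2 * (-((f q).2 : ℝ) ^ 2 / 2) = ((f q).2 : ℝ) ^ 2 by ring,
      Real.sqrt_sq h0.le]
  · rintro ⟨q, h1, h2⟩
    refine ⟨t, q, rfl, h1, ?_⟩
    have h0 : 0 < ((f q).2 : ℝ) := (f q).2.2.1
    rw [h2] at h0 ⊢
    rw [Real.sq_sqrt (Real.sqrt_pos.1 h0).le]
    ring

end Lift

end

section LinearAlgebra

variable {V : Type*} [AddCommGroup V] [Module ℝ V] [FiniteDimensional ℝ V]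
  {W : Type*} [AddCommGroup W] [Module ℝ W]

lemma apply_sharp {B : LinearMap.BilinForm ℝ V} (hB : B.Nondegenerate) (α : Module.Dual ℝ V)
    (w : V) : B (sharp B α) w = α w := by
  rw [sharp, dif_pos hB, LinearMap.BilinForm.apply_toDual_symm_apply]

lemma sharp_eq {B : LinearMap.BilinForm ℝ V} (hB : B.Nondegenerate) {α : Module.Dual ℝ V} {v : V}
    (h : ∀ w, B v w = α w) : sharp B α = v := by
  refine sub_eq_zero.1 (hB.1 _ fun w ↦ ?_)
  rw [map_sub, LinearMap.sub_apply, apply_sharp hB, h, sub_self]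

lemma sharp_add (B : LinearMap.BilinForm ℝ V) (α β : Module.Dual ℝ V) :
    sharp B (α + β) = sharp B α + sharp B β := by
  unfold sharp
  split_ifs <;> simp

lemma sharp_smul (B : LinearMap.BilinForm ℝ V) (c : ℝ) (α : Module.Dual ℝ V) :
    sharp B (c • α) = c • sharp B α := by
  unfold sharp
  split_ifs <;> simp

/-- `sharp B` as a linear map. -/
noncomputable def sharpLinear (B : LinearMap.BilinForm ℝ V) : Module.Dual ℝ V →ₗ[ℝ] V where
  toFun := sharp B
  map_add' := sharp_add B
  map_smul' := sharp_smul B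

@[simp]
lemma sharpLinear_apply (B : LinearMap.BilinForm ℝ V) (α : Module.Dual ℝ V) :
    sharpLinear B α = sharp B α := rfl

/-- The metric trace can be computed in any basis. -/
lemma metricTrace_eq_sum (B : LinearMap.BilinForm ℝ V) (L : V →ₗ[ℝ] V →ₗ[ℝ] W) {ι : Type*}
    [Fintype ι] (b : Module.Basis ι ℝ V) :
    metricTrace B (fun u v ↦ L u v) = ∑ i, L (b i) (sharp B (b.coord i)) := by
  classical
  set e := Module.finBasis ℝ V
  have h (i) : L (b i) (sharp B (b.coord i)) =
      ∑ j, e.coord j (b i) • L (e j) (sharp B (b.coord i)) := by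
    conv_lhs => rw [← e.sum_repr (b i)]
    simp only [map_sum, map_smul, LinearMap.sum_apply, LinearMap.smul_apply,
      Module.Basis.coord_apply]
  simp only [metricTrace, h]
  rw [Finset.sum_comm]
  refine Finset.sum_congr rfl fun j _ ↦ ?_
  simp only [← map_smul, ← map_sum, ← sharpLinear_apply]
  congr 2
  exact (b.sum_dual_apply_smul_coord (e.coord j)).symm

lemma metricTrace_map (B : LinearMap.BilinForm ℝ V) (L : V → V → W) {W' : Type*} [AddCommGroup W']
    [Module ℝ W'] (φ : W →ₗ[ℝ] W') :
    metricTrace B (fun u v ↦ φ (L u v)) = φ (metricTrace B L) := by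
  simp [metricTrace]

omit [FiniteDimensional ℝ V] in
/-- `c • τ ⊗ τ + m • B` on `ℝ × V`, where `τ (s, v) = s + ℓ v`, is nondegenerate iff `B` is. -/
lemma nondegenerate_prod_iff {B : LinearMap.BilinForm ℝ V} {B' : LinearMap.BilinForm ℝ (ℝ × V)}
    {ℓ : V →ₗ[ℝ] ℝ} {c m : ℝ} (hc : c ≠ 0) (hm : m ≠ 0)
    (h : ∀ x y, B' x y = c * (x.1 + ℓ x.2) * (y.1 + ℓ y.2) + m * B x.2 y.2) :
    B'.Nondegenerate ↔ B.Nondegenerate := by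
  constructor
  · rintro ⟨hl, hr⟩
    constructor
    · intro v hv
      have := hl (-ℓ v, v) fun y ↦ by simp [h, hv]
      exact (Prod.ext_iff.1 this).2
    · intro v hv
      have := hr (-ℓ v, v) fun y ↦ by simp [h, hv]
      exact (Prod.ext_iff.1 this).2
  · rintro ⟨hl, hr⟩
    constructor
    · intro x hx
      have h2 : x.2 = 0 := hl _ fun v ↦ by simpa [h, hm] using hx (-ℓ v, v)
      have h1 : x.1 = 0 := by simpa [h, hc, h2] using hx (1, 0)
      exact Prod.ext h1 h2
    · intro x hx
      have h2 : x.2 = 0 := hr _ fun v ↦ by simpa [h, hm] using hx (-ℓ v, v)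
      have h1 : x.1 = 0 := by simpa [h, hc, h2] using hx (1, 0)
      exact Prod.ext h1 h2

omit [FiniteDimensional ℝ V] in
lemma nondegenerate_compl₁₂_iff {V' : Type*} [AddCommGroup V'] [Module ℝ V']
    (B : LinearMap.BilinForm ℝ V) (e : V' ≃ₗ[ℝ] V) :
    LinearMap.BilinForm.Nondegenerate
      (B.compl₁₂ (e : V' →ₗ[ℝ] V) (e : V' →ₗ[ℝ] V)) ↔ B.Nondegenerate :=
  LinearMap.BilinForm.nondegenerate_congr_iff (B := B) (e := e.symm)

/-- The trace with respect to `c • τ ⊗ τ + m • B` on `ℝ × V`, where `τ (s, v) = s + ℓ v`. -/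
lemma metricTrace_prod {B : LinearMap.BilinForm ℝ V} {B' : LinearMap.BilinForm ℝ (ℝ × V)}
    {ℓ : V →ₗ[ℝ] ℝ} {c m : ℝ} (hc : c ≠ 0) (hm : m ≠ 0)
    (h : ∀ x y, B' x y = c * (x.1 + ℓ x.2) * (y.1 + ℓ y.2) + m * B x.2 y.2)
    (hB : B.Nondegenerate) (L : ℝ × V →ₗ[ℝ] ℝ × V →ₗ[ℝ] W) :
    metricTrace B' (fun u v ↦ L u v) = c⁻¹ • L (1, 0) (1, 0) +
      m⁻¹ • metricTrace B (fun u v ↦ L (-ℓ u, u) (-ℓ v, v)) := by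
  have hB' := (nondegenerate_prod_iff hc hm h).2 hB
  let Ψ : (ℝ × V) ≃ₗ[ℝ] (ℝ × V) :=
    { toFun := fun x ↦ (x.1 - ℓ x.2, x.2)
      map_add' := fun x y ↦ by ext <;> simp; ring
      map_smul' := fun a x ↦ by ext <;> simp; ring
      invFun := fun x ↦ (x.1 + ℓ x.2, x.2)
      left_inv := fun x ↦ by simp
      right_inv := fun x ↦ by simp }
  have hΨ (x) : Ψ x = (x.1 - ℓ x.2, x.2) := rfl
  have hΨs (x) : Ψ.symm x = (x.1 + ℓ x.2, x.2) := rfl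
  set e := Module.finBasis ℝ V
  set b := ((Module.Basis.singleton Unit ℝ).prod e).map Ψ with hb
  have hs1 : sharp B' (b.coord (Sum.inl ())) = c⁻¹ • ((1, 0) : ℝ × V) := by
    refine sharp_eq hB' fun w ↦ ?_
    simp [h, hb, hΨs, Module.Basis.prod]
    field_simp
  have hs2 (i) : sharp B' (b.coord (Sum.inr i)) =
      m⁻¹ • (-ℓ (sharp B (e.coord i)), sharp B (e.coord i)) := by
    refine sharp_eq hB' fun w ↦ ?_
    simp [h, hb, hΨs, Module.Basis.prod, apply_sharp hB]
    field_simp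
  rw [metricTrace_eq_sum B' L b, Fintype.sum_sum_type]
  simp only [hs1, hs2, map_smul, metricTrace, Finset.smul_sum, Finset.univ_unique,
    Finset.sum_singleton]
  congr 1
  · congr 2
    all_goals simp [hb, hΨ]
  · refine Finset.sum_congr rfl fun i _ ↦ ?_
    congr 2
    simp [hb, hΨ, e]

end LinearAlgebra

section Geometry

variable {E : Type*} [NormedAddCommGroup E] [NormedSpace ℝ E]
  {H : Type*} [TopologicalSpace H]
  {N : Type*} [TopologicalSpace N]
  (I : ModelWithCorners ℝ E H) [ChartedSpace H N] [FiniteDimensional ℝ E]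
  {E' : Type*} [NormedAddCommGroup E'] [NormedSpace ℝ E'] [FiniteDimensional ℝ E']
  {H' : Type*} [TopologicalSpace H'] (J : ModelWithCorners ℝ E' H')
  {S : Type*} [TopologicalSpace S] [ChartedSpace H' S]

/-- The derivative at `x` of the components of `g` in the chart at `x`. -/
noncomputable def metricDeriv (g : BilinField I N) (x : N) : E →L[ℝ] E →L[ℝ] E →L[ℝ] ℝ :=
  fderiv ℝ (metricInChart I g x) (extChartAt I x x)

lemma formAt_christoffel {g : BilinField I N} {x : N} (hg : (formAt I g x).Nondegenerate)
    (u v w : E) : formAt I g x (christoffel I g x u v) w =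
      2⁻¹ * (metricDeriv I g x u v w + metricDeriv I g x v u w - metricDeriv I g x w u v) := by
  rw [christoffel, apply_sharp hg]
  rfl

lemma christoffel_eq {g : BilinField I N} {x : N} (hg : (formAt I g x).Nondegenerate)
    {u v z : E} (h : ∀ w, formAt I g x z w =
      2⁻¹ * (metricDeriv I g x u v w + metricDeriv I g x v u w - metricDeriv I g x w u v)) :
    christoffel I g x u v = z :=
  sharp_eq hg h

/-- The Christoffel symbols as a bilinear map. -/
noncomputable def christoffelBilin {g : BilinField I N} {x : N}
    (hg : (formAt I g x).Nondegenerate) : E →ₗ[ℝ] E →ₗ[ℝ] E :=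
  LinearMap.mk₂ ℝ (christoffel I g x)
    (fun a b c ↦ christoffel_eq I hg fun w ↦ by
      simp only [map_add, LinearMap.add_apply, formAt_christoffel I hg, add_apply]
      ring)
    (fun r a c ↦ christoffel_eq I hg fun w ↦ by
      simp only [map_smul, LinearMap.smul_apply, formAt_christoffel I hg, smul_apply, smul_eq_mul]
      ring)
    (fun c a b ↦ christoffel_eq I hg fun w ↦ by
      simp only [map_add, LinearMap.add_apply, formAt_christoffel I hg, add_apply]
      ring)
    (fun r c a ↦ christoffel_eq I hg fun w ↦ by
      simp only [map_smul, LinearMap.smul_apply, formAt_christoffel I hg, smul_apply, smul_eq_mul]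
      ring)

/-- The covariant Hessian as a bilinear map. -/
noncomputable def covariantHessianBilin {g : BilinField I N} {f : S → N} {q : S}
    (hg : (formAt I g (f q)).Nondegenerate) : E' →ₗ[ℝ] E' →ₗ[ℝ] E :=
  (fderiv ℝ (fderiv ℝ (writtenInExtChartAt J I q f)) (extChartAt J q q)).toLinearMap₁₂ +
    (christoffelBilin I hg).compl₁₂ (differential I J f q : E' →ₗ[ℝ] E)
      (differential I J f q : E' →ₗ[ℝ] E)

omit [FiniteDimensional ℝ E'] in
@[simp]
lemma covariantHessianBilin_apply {g : BilinField I N} {f : S → N} {q : S}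
    (hg : (formAt I g (f q)).Nondegenerate) (a b : E') :
    covariantHessianBilin I J hg a b = covariantHessian I J g f q a b := rfl

omit [FiniteDimensional ℝ E'] in
lemma formAt_covariantHessian {g : BilinField I N} {f : S → N} {q : S}
    (hg : (formAt I g (f q)).Nondegenerate) (a b : E') (w : E) :
    formAt I g (f q) (covariantHessian I J g f q a b) w =
      formAt I g (f q)
        (fderiv ℝ (fderiv ℝ (writtenInExtChartAt J I q f)) (extChartAt J q q) a b) w +
      2⁻¹ * (metricDeriv I g (f q) (differential I J f q a) (differential I J f q b) w +
        metricDeriv I g (f q) (differential I J f q b) (differential I J f q a) w -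
        metricDeriv I g (f q) w (differential I J f q a) (differential I J f q b)) := by
  rw [covariantHessian, map_add, LinearMap.add_apply, formAt_christoffel I hg]

/-- The projection to the normal space as a linear map. -/
noncomputable def normalPartLinear (g : BilinField I N) (f : S → N) (q : S) : E →ₗ[ℝ] E :=
  LinearMap.id - (differential I J f q : E' →ₗ[ℝ] E) ∘ₗ sharpLinear (inducedForm I J g f q) ∘ₗ
    LinearMap.lcomp ℝ ℝ (differential I J f q : E' →ₗ[ℝ] E) ∘ₗ formAt I g (f q)

omit [FiniteDimensional ℝ E] in
lemma normalPartLinear_apply (g : BilinField I N) (f : S → N) (q : S) (w : E) :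
    normalPartLinear I J g f q w = normalPart I J g f q w := rfl

omit [FiniteDimensional ℝ E] in
lemma normalPart_eq_zero_iff {g : BilinField I N} {f : S → N} {q : S}
    (h : (inducedForm I J g f q).Nondegenerate) (w : E) :
    normalPart I J g f q w = 0 ↔ ∃ a, differential I J f q a = w := by
  constructor
  · intro hw
    exact ⟨_, (sub_eq_zero.1 hw).symm⟩
  · rintro ⟨a, rfl⟩
    exact sub_eq_zero.2 (congrArg _ (sharp_eq (v := a) h fun w ↦ rfl).symm)

/-- The mean curvature vector vanishes iff the trace of the covariant Hessian is tangential. -/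
lemma meanCurvature_eq_zero_iff [Nontrivial E'] {g : BilinField I N} {f : S → N} {q : S}
    (h : (inducedForm I J g f q).Nondegenerate) :
    meanCurvature I J g f q = 0 ↔ ∃ a, differential I J f q a =
      metricTrace (inducedForm I J g f q) (covariantHessian I J g f q) := by
  rw [← normalPart_eq_zero_iff I J h, meanCurvature, smul_eq_zero, or_iff_right]
  · rw [← normalPartLinear_apply, ← metricTrace_map]
    rfl
  · simpa using Module.finrank_pos.ne'

end Geometry

section Cone

variable {V W S : Type*} [AddCommGroup V] [Module ℝ V]
  [AddCommGroup W] [Module ℝ W] [AddCommGroup S] [Module ℝ S]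

/-- If `B'` on `W ≃ ℝ × V` has the cone form `c • τ ⊗ τ + m • B`, where `τ (s, v) = s + ℓ v`, and
the components of `T'` orthogonal to the ray are those of `T`, then `T'` lies in the cone over the
range of `D` iff `T` lies in the range of `D`. -/
lemma mem_range_cone_iff {B : LinearMap.BilinForm ℝ V} {B' : LinearMap.BilinForm ℝ W}
    (hB : B.Nondegenerate) {κ : (ℝ × V) ≃ₗ[ℝ] W} {ℓ : V →ₗ[ℝ] ℝ} {c m : ℝ} (hm : m ≠ 0)
    (h : ∀ x y, B' (κ x) (κ y) = c * (x.1 + ℓ x.2) * (y.1 + ℓ y.2) + m * B x.2 y.2)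
    {D : S → V} (hD : ∀ (r : ℝ) (a : S), D (r • a) = r • D a) {D' : ℝ × S → W}
    (hD' : ∀ x, D' x = κ (x.1, D x.2)) {T : V} {T' : W}
    (hT : ∀ w, B' T' (κ (-ℓ w, w)) = B T w) :
    (∃ x, D' x = T') ↔ ∃ a, D a = T := by
  obtain ⟨⟨s, v⟩, rfl⟩ := κ.surjective T'
  have hv : m • v = T := by
    refine sub_eq_zero.1 (hB.1 _ fun w ↦ ?_)
    have := hT w
    simp only [h, neg_add_cancel, mul_zero, zero_add] at this
    simp [this]
  simp only [hD', κ.injective.eq_iff, Prod.mk.injEq]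
  constructor
  · rintro ⟨x, -, hx⟩
    exact ⟨m • x.2, by rw [hD, hx, hv]⟩
  · rintro ⟨a, ha⟩
    exact ⟨(s, m⁻¹ • a), rfl, by rw [hD, ha, ← hv, inv_smul_smul₀ hm]⟩

end Cone

section Charts

lemma extChartAt_opens_target {U : TopologicalSpace.Opens ℝ} (x : U) :
    (extChartAt 𝓘(ℝ, ℝ) x).target = U := by
  ext z
  constructor
  · intro hz
    rw [← (extChartAt 𝓘(ℝ, ℝ) x).right_inv hz]
    exact ((extChartAt 𝓘(ℝ, ℝ) x).symm z).2
  · intro hz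
    exact (extChartAt 𝓘(ℝ, ℝ) x).map_source (x := ⟨z, hz⟩) (by
      rw [extChartAt_source, TopologicalSpace.Opens.chartAt_eq,
        OpenPartialHomeomorph.subtypeRestr_source]
      exact mem_chart_source ℝ z)

lemma coe_extChartAt_opens_symm {U : TopologicalSpace.Opens ℝ} (x : U) {z : ℝ} (hz : z ∈ U) :
    ((extChartAt 𝓘(ℝ, ℝ) x).symm z : ℝ) = z :=
  (extChartAt 𝓘(ℝ, ℝ) x).right_inv (by rwa [extChartAt_opens_target])

lemma hasMFDerivAt_extChartAt_opens_symm {U : TopologicalSpace.Opens ℝ} (x : U) {z : ℝ}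
    (hz : z ∈ U) : HasMFDerivAt 𝓘(ℝ, ℝ) 𝓘(ℝ, ℝ) (extChartAt 𝓘(ℝ, ℝ) x).symm z
      (ContinuousLinearMap.id ℝ ℝ) := by
  have hz' : z ∈ (extChartAt 𝓘(ℝ, ℝ) x).target := by rwa [extChartAt_opens_target]
  refine ⟨continuousAt_extChartAt_symm'' hz', ?_⟩
  refine (hasFDerivAt_id z).hasFDerivWithinAt.congr_of_eventuallyEq ?_ ?_
  · filter_upwards [mem_nhdsWithin_of_mem_nhds (U.isOpen.mem_nhds hz)] with y hy
    exact coe_extChartAt_opens_symm x hy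
  · exact coe_extChartAt_opens_symm x hz

variable {E : Type*} [NormedAddCommGroup E] [NormedSpace ℝ E]
  {H : Type*} [TopologicalSpace H] (I : ModelWithCorners ℝ E H) [I.Boundaryless]
  {M : Type*} [TopologicalSpace M] [ChartedSpace H M]

lemma mdifferentiableAt_extChartAt_symm [IsManifold I 1 M] (p : M) {z : E} (hz : z ∈ (extChartAt I p).target) :
    MDifferentiableAt 𝓘(ℝ, E) I (extChartAt I p).symm z := by
  have := mdifferentiableWithinAt_extChartAt_symm hz
  rwa [I.range_eq_univ, mdifferentiableWithinAt_univ] at this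

/-- The differential of the inverse of the chart at `p`, as an endomorphism of the model space. -/
noncomputable def chartSymmDeriv (p : M) (z : E) : E →L[ℝ] E := mfderiv 𝓘(ℝ, E) I (extChartAt I p).symm z

omit [I.Boundaryless] in
lemma metricInChart_apply (g : BilinField I M) (p : M) (z u v : E) :
    metricInChart I g p z u v = formAt I g ((extChartAt I p).symm z)
      (chartSymmDeriv I p z u) (chartSymmDeriv I p z v) := rfl

lemma chartSymmDeriv_self [IsManifold I 1 M] (p : M) :
    chartSymmDeriv I p (extChartAt I p p) = ContinuousLinearMap.id ℝ E := by
  rw [chartSymmDeriv, ← mfderivWithin_univ, ← I.range_eq_univ]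
  exact mfderivWithin_range_extChartAt_symm

lemma metricInChart_self [IsManifold I 1 M] (g : BilinField I M) (p : M) (u v : E) :
    metricInChart I g p (extChartAt I p p) u v = formAt I g p u v := by
  rw [metricInChart_apply, chartSymmDeriv_self, extChartAt_to_inv]
  rfl

variable {I} in
/-- The vector fields that are constant in the chart at `p` are smooth near `p`. -/
lemma contMDiffAt_mfderiv_extChartAt_symm [IsManifold I ∞ M] (p : M) (v : E) :
    ContMDiffAt 𝓘(ℝ, E) I.tangent ∞ (fun z : E ↦ (Bundle.TotalSpace.mk' E
      (E := (TangentSpace I : M → Type _)) ((extChartAt I p).symm z)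
      (mfderiv 𝓘(ℝ, E) I (extChartAt I p).symm z v))) (extChartAt I p p) := by
  have htgt := extChartAt_target_mem_nhds (I := I) p
  set e := trivializationAt E (TangentSpace I : M → Type _) p
  have hmem : ∀ z ∈ (extChartAt I p).target, (extChartAt I p).symm z ∈ (chartAt H p).source :=
    fun z hz ↦ by simpa using (extChartAt I p).map_target hz
  rw [e.contMDiffAt_iff]
  · refine ⟨(contMDiffOn_extChartAt_symm p).contMDiffAt htgt, ?_⟩
    refine (contMDiffAt_const (c := v)).congr_of_eventuallyEq ?_
    filter_upwards [htgt] with z hz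
    have h := hmem z hz
    have h2 := TangentBundle.symmL_trivializationAt (I := I) h
    rw [(extChartAt I p).right_inv hz, I.range_eq_univ, mfderivWithin_univ] at h2
    have h3 : mfderiv 𝓘(ℝ, E) I (extChartAt I p).symm z v =
        e.symm ((extChartAt I p).symm z) v := by
      rw [← h2]
      exact e.symmL_apply h v
    rw [h3]
    exact congrArg Prod.snd (e.apply_mk_symm h v)
  · exact e.mem_source.2 (hmem _ (mem_extChartAt_target p))

end Charts

section Family

variable {E : Type*} [NormedAddCommGroup E] [NormedSpace ℝ E] [FiniteDimensional ℝ E]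
  {H : Type*} [TopologicalSpace H] {I : ModelWithCorners ℝ E H} [I.Boundaryless]
  {M : Type*} [TopologicalSpace M] [ChartedSpace H M] [IsManifold I ∞ M]

omit [FiniteDimensional ℝ E] in
lemma contDiffAt_clm_of_apply {D F G : Type*} [NormedAddCommGroup D] [NormedSpace ℝ D]
    [NormedAddCommGroup F] [NormedSpace ℝ F] [FiniteDimensional ℝ F]
    [NormedAddCommGroup G] [NormedSpace ℝ G] {f : D → F →L[ℝ] G} {x : D} {n : ℕ∞ω}
    (h : ∀ v, ContDiffAt ℝ n (fun y ↦ f y v) x) : ContDiffAt ℝ n f x := by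
  have hd : Module.finrank ℝ F = Module.finrank ℝ (Fin (Module.finrank ℝ F) → ℝ) :=
    (Module.finrank_fin_fun ℝ).symm
  let e₁ := ContinuousLinearEquiv.ofFinrankEq hd
  let e₂ := (e₁.arrowCongr (1 : G ≃L[ℝ] G)).trans
    (ContinuousLinearEquiv.piRing (Fin (Module.finrank ℝ F)))
  rw [← Function.id_comp f, ← e₂.symm_comp_self]
  exact e₂.symm.contDiff.contDiffAt.comp x (contDiffAt_pi.2 fun i ↦ h _)

lemma IsSmoothMetricFamily.contDiffAt_metricInChart {ε : ℝ} {γ : ℝ → BilinField I M}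
    (hγ : IsSmoothMetricFamily I ε γ) (p : M) {ρ : ℝ} (hρ : ρ ∈ Ioo (-ε) ε) :
    ContDiffAt ℝ ∞ (fun x : E × ℝ ↦ metricInChart I (γ x.2) p x.1) (extChartAt I p p, ρ) := by
  refine contDiffAt_clm_of_apply fun u ↦ contDiffAt_clm_of_apply fun v ↦ ?_
  rw [← contMDiffAt_iff_contDiffAt]
  have hsymm : ContMDiffAt (𝓘(ℝ, E).prod 𝓘(ℝ, ℝ)) I ∞
      (fun x : E × ℝ ↦ (extChartAt I p).symm x.1) (extChartAt I p p, ρ) :=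
    ContMDiffAt.comp (extChartAt I p p, ρ) ((contMDiffOn_extChartAt_symm p).contMDiffAt
      (extChartAt_target_mem_nhds p)) contMDiffAt_fst
  have hv (v : E) : ContMDiffAt (𝓘(ℝ, E).prod 𝓘(ℝ, ℝ)) I.tangent ∞ (fun x : E × ℝ ↦
      (Bundle.TotalSpace.mk' E (E := (TangentSpace I : M → Type _)) ((extChartAt I p).symm x.1)
      (mfderiv 𝓘(ℝ, E) I (extChartAt I p).symm x.1 v))) (extChartAt I p p, ρ) :=
    ContMDiffAt.comp (extChartAt I p p, ρ) (contMDiffAt_mfderiv_extChartAt_symm p v)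
      contMDiffAt_fst
  have hg : ContMDiffAt (𝓘(ℝ, E).prod 𝓘(ℝ, ℝ)) (I.prod 𝓘(ℝ, E →L[ℝ] E →L[ℝ] ℝ)) ∞
      (fun x : E × ℝ ↦ Bundle.TotalSpace.mk' (E →L[ℝ] E →L[ℝ] ℝ)
        (E := fun p : M ↦ (TangentSpace I p →L[ℝ] TangentSpace I p →L[ℝ] ℝ))
        ((extChartAt I p).symm x.1) (γ x.2 ((extChartAt I p).symm x.1)))
      (extChartAt I p p, ρ) := by
    refine ContMDiffAt.comp_of_eq (f := fun x : E × ℝ ↦ ((extChartAt I p).symm x.1, x.2))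
      (y := (p, ρ)) (hγ.smooth.contMDiffAt ?_) (hsymm.prodMk contMDiffAt_snd) (by simp)
    exact prod_mem_nhds Filter.univ_mem (isOpen_Ioo.mem_nhds hρ)
  have := hg.clm_bundle_apply₂ (E₃ := Bundle.Trivial M ℝ) (F₃ := ℝ) (hv u) (hv v)
  rw [Bundle.contMDiffAt_totalSpace] at this
  rw [modelWithCornersSelf_prod, ← chartedSpaceSelf_prod]
  exact this.2

end Family

section MetricDeriv

lemma HasFDerivAt.apply_apply_const {D E F G : Type*} [NormedAddCommGroup D] [NormedSpace ℝ D]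
    [NormedAddCommGroup E] [NormedSpace ℝ E] [NormedAddCommGroup F] [NormedSpace ℝ F]
    [NormedAddCommGroup G] [NormedSpace ℝ G] {f : D → E →L[ℝ] F →L[ℝ] G}
    {f' : D →L[ℝ] E →L[ℝ] F →L[ℝ] G} {x : D} (h : HasFDerivAt f f' x) (v : E) (w : F) :
    HasFDerivAt (fun z ↦ f z v w) ((f'.flip v).flip w) x := by
  have h1 := (h.clm_apply (hasFDerivAt_const v x)).clm_apply (hasFDerivAt_const w x)
  refine h1.congr_fderiv ?_
  ext
  simp

variable {E : Type*} [NormedAddCommGroup E] [NormedSpace ℝ E] [FiniteDimensional ℝ E]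
  {H : Type*} [TopologicalSpace H] (I : ModelWithCorners ℝ E H)
  {M : Type*} [TopologicalSpace M] [ChartedSpace H M]

lemma metricDeriv_eq {g : BilinField I M} {x : M} {F : E → E → E → ℝ}
    (hF : ∀ v w, ContDiffAt ℝ 1 (fun z ↦ F z v w) (extChartAt I x x))
    (h : ∀ᶠ z in nhds (extChartAt I x x), ∀ v w, metricInChart I g x z v w = F z v w)
    {u v w : E} {d : ℝ} (hd : HasDerivAt (fun s : ℝ ↦ F (extChartAt I x x + s • u) v w) d 0) :
    metricDeriv I g x u v w = d := by
  have h' (v w) : (fun z ↦ metricInChart I g x z v w) =ᶠ[nhds (extChartAt I x x)]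
      fun z ↦ F z v w := h.mono fun z hz ↦ hz v w
  have hc : ContDiffAt ℝ 1 (metricInChart I g x) (extChartAt I x x) :=
    contDiffAt_clm_of_apply fun v ↦ contDiffAt_clm_of_apply fun w ↦
      (hF v w).congr_of_eventuallyEq (h' v w)
  have hdiff := (hc.differentiableAt one_ne_zero).hasFDerivAt
  have h1 : HasFDerivAt (fun z ↦ metricInChart I g x z v w)
      (((metricDeriv I g x).flip v).flip w) (extChartAt I x x) :=
    hdiff.apply_apply_const v w
  exact ((h1.congr_of_eventuallyEq (h' v w).symm).hasLineDerivAt u).unique hd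

variable [I.Boundaryless] {H' E' M' : Type*} [NormedAddCommGroup E'] [NormedSpace ℝ E']
  [TopologicalSpace H'] (I' : ModelWithCorners ℝ E' H')
  [TopologicalSpace M'] [ChartedSpace H' M']

omit [FiniteDimensional ℝ E] [I.Boundaryless] in
lemma chartSymmDeriv_prod {p : M} {p' : M'} {z : E} {z' : E'}
    (h : MDifferentiableAt 𝓘(ℝ, E) I (extChartAt I p).symm z)
    (h' : MDifferentiableAt 𝓘(ℝ, E') I' (extChartAt I' p').symm z') :
    chartSymmDeriv (I.prod I') (p, p') (z, z') =
      (chartSymmDeriv I p z).prodMap (chartSymmDeriv I' p' z') := by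
  have := mfderiv_prodMap (p := (z, z')) h h'
  rw [← modelWithCornersSelf_prod, chartedSpaceSelf_prod] at this
  exact this

lemma chartSymmDeriv_opens {U : TopologicalSpace.Opens ℝ} (x : U) {z : ℝ} (hz : z ∈ U) :
    chartSymmDeriv 𝓘(ℝ, ℝ) x z = ContinuousLinearMap.id ℝ ℝ :=
  (hasMFDerivAt_extChartAt_opens_symm x hz).mfderiv

omit [FiniteDimensional ℝ E] [I.Boundaryless] in
lemma formAt_poincareMetric {ε₀ : ℝ} (γ : ℝ → BilinField I M) (x : PoincareSpace M ε₀)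
    (u v : E × ℝ) : formAt (I.prod 𝓘(ℝ, ℝ)) (poincareMetric I ε₀ γ) x u v =
      ((x.2 : ℝ) ^ 2)⁻¹ * (u.2 * v.2 + formAt I (γ (-(x.2 : ℝ) ^ 2 / 2)) x.1 u.1 v.1) := rfl

omit [FiniteDimensional ℝ E] [I.Boundaryless] in
lemma formAt_ambientMetric {ε : ℝ} (γ : ℝ → BilinField I M) (x : AmbientSpace M ε)
    (u v : ℝ × E × ℝ) :
    formAt (𝓘(ℝ, ℝ).prod (I.prod 𝓘(ℝ, ℝ))) (ambientMetric I ε γ) x u v =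
      2 * (x.2.2 : ℝ) * (u.1 * v.1) + (x.1 : ℝ) * (u.1 * v.2.2 + u.2.2 * v.1) +
        (x.1 : ℝ) ^ 2 * formAt I (γ (x.2.2 : ℝ)) x.2.1 u.2.1 v.2.1 := rfl

variable [IsManifold I 1 M]

omit [FiniteDimensional ℝ E] in
lemma metricInChart_poincareMetric {ε₀ : ℝ} (γ : ℝ → BilinField I M) (x : PoincareSpace M ε₀)
    {z : E × ℝ} (hz : z.1 ∈ (extChartAt I x.1).target) (hr : z.2 ∈ openInterval 0 ε₀)
    (u v : E × ℝ) : metricInChart (I.prod 𝓘(ℝ, ℝ)) (poincareMetric I ε₀ γ) x z u v =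
      (z.2 ^ 2)⁻¹ * (u.2 * v.2 + metricInChart I (γ (-z.2 ^ 2 / 2)) x.1 z.1 u.1 v.1) := by
  obtain ⟨p, r⟩ := x
  obtain ⟨z, s⟩ := z
  have h1 : (extChartAt (I.prod 𝓘(ℝ, ℝ)) (p, r)).symm (z, s) =
    ((extChartAt I p).symm z, (extChartAt 𝓘(ℝ, ℝ) r).symm s) := rfl
  rw [metricInChart_apply, h1, chartSymmDeriv_prod _ _ (mdifferentiableAt_extChartAt_symm I p hz)
    (hasMFDerivAt_extChartAt_opens_symm r hr).mdifferentiableAt, chartSymmDeriv_opens r hr,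
    formAt_poincareMetric, metricInChart_apply]
  simp only [coe_extChartAt_opens_symm r hr]
  rfl

omit [FiniteDimensional ℝ E] in
lemma metricInChart_ambientMetric {ε : ℝ} (γ : ℝ → BilinField I M) (x : AmbientSpace M ε)
    {z : ℝ × E × ℝ} (ht : z.1 ∈ posHalfLine) (hz : z.2.1 ∈ (extChartAt I x.2.1).target)
    (hr : z.2.2 ∈ openInterval (-ε) ε) (u v : ℝ × E × ℝ) :
    metricInChart (𝓘(ℝ, ℝ).prod (I.prod 𝓘(ℝ, ℝ))) (ambientMetric I ε γ) x z u v =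
      2 * z.2.2 * (u.1 * v.1) + z.1 * (u.1 * v.2.2 + u.2.2 * v.1) +
        z.1 ^ 2 * metricInChart I (γ z.2.2) x.2.1 z.2.1 u.2.1 v.2.1 := by
  obtain ⟨t, p, r⟩ := x
  obtain ⟨a, z, s⟩ := z
  have h1 : (extChartAt (𝓘(ℝ, ℝ).prod (I.prod 𝓘(ℝ, ℝ))) (t, p, r)).symm (a, z, s) =
    ((extChartAt 𝓘(ℝ, ℝ) t).symm a, (extChartAt I p).symm z, (extChartAt 𝓘(ℝ, ℝ) r).symm s) := rfl
  have h2 := mdifferentiableAt_extChartAt_symm I p hz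
  have h3 := (hasMFDerivAt_extChartAt_opens_symm r hr).mdifferentiableAt
  have h4 : MDifferentiableAt 𝓘(ℝ, E × ℝ) (I.prod 𝓘(ℝ, ℝ))
      (extChartAt (I.prod 𝓘(ℝ, ℝ)) (p, r)).symm (z, s) := by
    have := MDifferentiableAt.prodMap' (p := (z, s)) h2 h3
    rw [← modelWithCornersSelf_prod, chartedSpaceSelf_prod] at this
    exact this
  rw [metricInChart_apply, h1, chartSymmDeriv_prod _ _
    (hasMFDerivAt_extChartAt_opens_symm t ht).mdifferentiableAt h4, chartSymmDeriv_opens t ht,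
    chartSymmDeriv_prod _ _ h2 h3, chartSymmDeriv_opens r hr,
    formAt_ambientMetric, metricInChart_apply]
  simp only [coe_extChartAt_opens_symm r hr, coe_extChartAt_opens_symm t ht]
  rfl

end MetricDeriv

section Family

variable {E : Type*} [NormedAddCommGroup E] [NormedSpace ℝ E] [FiniteDimensional ℝ E]
  {H : Type*} [TopologicalSpace H] (I : ModelWithCorners ℝ E H) [I.Boundaryless]
  {M : Type*} [TopologicalSpace M] [ChartedSpace H M] [IsManifold I ∞ M]

/-- The derivative at `(p, ρ)` of the components `(z, ρ) ↦ (γ ρ)_{ij}(z)` in the chart at `p`. -/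
noncomputable def familyDeriv (γ : ℝ → BilinField I M) (p : M) (ρ : ℝ) :
    E × ℝ →L[ℝ] E →L[ℝ] E →L[ℝ] ℝ :=
  fderiv ℝ (fun x : E × ℝ ↦ metricInChart I (γ x.2) p x.1) (extChartAt I p p, ρ)

variable {I} {γ : ℝ → BilinField I M} {ε : ℝ}

lemma IsSmoothMetricFamily.contDiffAt_metricInChart_apply (hγ : IsSmoothMetricFamily I ε γ) (p : M)
    {ρ : ℝ} (hρ : ρ ∈ Ioo (-ε) ε) (v w : E) :
    ContDiffAt ℝ 1 (fun x : E × ℝ ↦ metricInChart I (γ x.2) p x.1 v w) (extChartAt I p p, ρ) :=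
  (((hγ.contDiffAt_metricInChart p hρ).clm_apply contDiffAt_const).clm_apply
    contDiffAt_const).of_le (by exact_mod_cast le_top)

lemma IsSmoothMetricFamily.hasDerivAt_metricInChart (hγ : IsSmoothMetricFamily I ε γ) (p : M)
    {ρ : ℝ} (hρ : ρ ∈ Ioo (-ε) ε) {c : ℝ → E × ℝ} {c' : E × ℝ} (hc : HasDerivAt c c' 0)
    (hc0 : c 0 = (extChartAt I p p, ρ)) (v w : E) :
    HasDerivAt (fun s ↦ metricInChart I (γ (c s).2) p (c s).1 v w) (familyDeriv I γ p ρ c' v w) 0 := by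
  have hdiff := ((hγ.contDiffAt_metricInChart p hρ).differentiableAt (by simp)).hasFDerivAt
  have h1 : HasFDerivAt (fun x : E × ℝ ↦ metricInChart I (γ x.2) p x.1 v w)
      (((familyDeriv I γ p ρ).flip v).flip w) (extChartAt I p p, ρ) :=
    hdiff.apply_apply_const v w
  rw [← hc0] at h1
  exact h1.comp_hasDerivAt 0 hc

lemma IsSmoothMetricFamily.metricDeriv_poincareMetric (hγ : IsSmoothMetricFamily I ε γ) {ε₀ : ℝ}
    (hε : ε₀ ^ 2 ≤ 2 * ε) (x : PoincareSpace M ε₀) (u v w : E × ℝ) :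
    metricDeriv (I.prod 𝓘(ℝ, ℝ)) (poincareMetric I ε₀ γ) x u v w =
      -2 * ((x.2 : ℝ) ^ 3)⁻¹ * u.2 *
          (v.2 * w.2 + formAt I (γ (-(x.2 : ℝ) ^ 2 / 2)) x.1 v.1 w.1) +
        ((x.2 : ℝ) ^ 2)⁻¹ *
          familyDeriv I γ x.1 (-(x.2 : ℝ) ^ 2 / 2) (u.1, -(x.2 : ℝ) * u.2) v.1 w.1 := by
  have : IsManifold I 1 M := IsManifold.of_le (n := ∞) (by exact_mod_cast le_top)
  obtain ⟨p, r, hr⟩ := x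
  have hr0 : r ≠ 0 := hr.1.ne'
  have hρ := neg_sq_div_two_mem hε hr
  refine metricDeriv_eq (F := fun z u v ↦ (z.2 ^ 2)⁻¹ * (u.2 * v.2 +
    metricInChart I (γ (-z.2 ^ 2 / 2)) p z.1 u.1 v.1)) _ ?_ ?_ ?_
  · intro v w
    change ContDiffAt ℝ 1 _ (extChartAt I p p, r)
    have h2 : ContDiffAt ℝ 1 (fun z : E × ℝ ↦ z.2 ^ 2) (extChartAt I p p, r) := by fun_prop
    refine (h2.inv (by simpa)).mul (contDiffAt_const.add ?_)
    exact ContDiffAt.comp (f := fun z : E × ℝ ↦ (z.1, -z.2 ^ 2 / 2)) (extChartAt I p p, r)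
      (hγ.contDiffAt_metricInChart_apply p hρ v.1 w.1) (by fun_prop)
  · change ∀ᶠ z in nhds (extChartAt I p p, r), _
    filter_upwards [prod_mem_nhds (extChartAt_target_mem_nhds (I := I) p)
      ((openInterval 0 ε₀).isOpen.mem_nhds hr)] with z hz v w
    exact metricInChart_poincareMetric I γ _ hz.1 hz.2 v w
  · change HasDerivAt (fun s : ℝ ↦ ((r + s * u.2) ^ 2)⁻¹ * (v.2 * w.2 + metricInChart I
      (γ (-(r + s * u.2) ^ 2 / 2)) p (extChartAt I p p + s • u.1) v.1 w.1)) _ 0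
    have h1 : HasDerivAt (fun s : ℝ ↦ r + s * u.2) u.2 0 := by
      simpa using ((hasDerivAt_id (0 : ℝ)).mul_const u.2).const_add r
    have h2 : HasDerivAt (fun s : ℝ ↦ extChartAt I p p + s • u.1) u.1 0 := by
      simpa using ((hasDerivAt_id (0 : ℝ)).smul_const u.1).const_add (extChartAt I p p)
    have h3 := hγ.hasDerivAt_metricInChart p hρ (h2.prodMk ((h1.pow 2).neg.div_const 2))
      (by simp) v.1 w.1
    have h4 := ((h1.pow 2).inv (by simpa)).mul (h3.const_add (v.2 * w.2))
    refine h4.congr_deriv ?_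
    simp only [Pi.pow_apply, Pi.neg_apply, Pi.inv_apply, zero_mul, zero_smul, add_zero,
      metricInChart_self]
    have h5 : -(((2 : ℕ) : ℝ) * r ^ (2 - 1) * u.2) / 2 = -r * u.2 := by norm_num; ring
    rw [h5]
    norm_num
    field_simp

lemma IsSmoothMetricFamily.metricDeriv_ambientMetric (hγ : IsSmoothMetricFamily I ε γ)
    (x : AmbientSpace M ε) (u v w : ℝ × E × ℝ) :
    metricDeriv (𝓘(ℝ, ℝ).prod (I.prod 𝓘(ℝ, ℝ))) (ambientMetric I ε γ) x u v w =
      2 * u.2.2 * (v.1 * w.1) + u.1 * (v.1 * w.2.2 + v.2.2 * w.1) +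
        2 * (x.1 : ℝ) * u.1 * formAt I (γ (x.2.2 : ℝ)) x.2.1 v.2.1 w.2.1 +
        (x.1 : ℝ) ^ 2 * familyDeriv I γ x.2.1 (x.2.2 : ℝ) u.2 v.2.1 w.2.1 := by
  have : IsManifold I 1 M := IsManifold.of_le (n := ∞) (by exact_mod_cast le_top)
  obtain ⟨⟨t, ht⟩, p, ρ, hρ⟩ := x
  refine metricDeriv_eq (F := fun z u v ↦ 2 * z.2.2 * (u.1 * v.1) +
    z.1 * (u.1 * v.2.2 + u.2.2 * v.1) +
        z.1 ^ 2 * metricInChart I (γ z.2.2) p z.2.1 u.2.1 v.2.1) _ ?_ ?_ ?_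
  · intro v w
    change ContDiffAt ℝ 1 _ (t, extChartAt I p p, ρ)
    have h2 : ContDiffAt ℝ 1 (fun z : ℝ × E × ℝ ↦ metricInChart I (γ z.2.2) p z.2.1 v.2.1 w.2.1)
        (t, extChartAt I p p, ρ) :=
      ContDiffAt.comp (f := fun z : ℝ × E × ℝ ↦ z.2) (t, extChartAt I p p, ρ)
        (hγ.contDiffAt_metricInChart_apply p hρ v.2.1 w.2.1) (by fun_prop)
    fun_prop
  · change ∀ᶠ z in nhds (t, extChartAt I p p, ρ), _
    filter_upwards [prod_mem_nhds (posHalfLine.isOpen.mem_nhds ht)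
      (prod_mem_nhds (extChartAt_target_mem_nhds (I := I) p)
      ((openInterval (-ε) ε).isOpen.mem_nhds hρ))] with z hz v w
    exact metricInChart_ambientMetric I γ _ hz.1 hz.2.1 hz.2.2 v w
  · change HasDerivAt (fun s : ℝ ↦ 2 * (ρ + s * u.2.2) * (v.1 * w.1) +
      (t + s * u.1) * (v.1 * w.2.2 + v.2.2 * w.1) + (t + s * u.1) ^ 2 * metricInChart I
      (γ (ρ + s * u.2.2)) p (extChartAt I p p + s • u.2.1) v.2.1 w.2.1) _ 0
    have h1 : HasDerivAt (fun s : ℝ ↦ ρ + s * u.2.2) u.2.2 0 := by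
      simpa using ((hasDerivAt_id (0 : ℝ)).mul_const u.2.2).const_add ρ
    have h0 : HasDerivAt (fun s : ℝ ↦ t + s * u.1) u.1 0 := by
      simpa using ((hasDerivAt_id (0 : ℝ)).mul_const u.1).const_add t
    have h2 : HasDerivAt (fun s : ℝ ↦ extChartAt I p p + s • u.2.1) u.2.1 0 := by
      simpa using ((hasDerivAt_id (0 : ℝ)).smul_const u.2.1).const_add (extChartAt I p p)
    have h3 := hγ.hasDerivAt_metricInChart p hρ (h2.prodMk h1) (by simp) v.2.1 w.2.1
    have h4 := (((h1.const_mul 2).mul_const (v.1 * w.1)).add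
      (h0.mul_const (v.1 * w.2.2 + v.2.2 * w.1))).add ((h0.pow 2).mul h3)
    refine h4.congr_deriv ?_
    simp only [Pi.pow_apply, zero_mul, zero_smul, add_zero, metricInChart_self]
    norm_num
    ring

end Family

section Calculus

variable {E E' : Type*} [NormedAddCommGroup E] [NormedSpace ℝ E]
  [NormedAddCommGroup E'] [NormedSpace ℝ E'] {F : E' → E × ℝ} {G : ℝ × E' → ℝ × E × ℝ}
  {t₀ : ℝ} {y₀ : E'}

lemma HasFDerivAt.cone {F' : E' →L[ℝ] E × ℝ} {x : ℝ × E'} (hF : HasFDerivAt F F' x.2) :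
    HasFDerivAt (fun x : ℝ × E' ↦ (x.1, (F x.2).1, -(F x.2).2 ^ 2 / 2))
      ((ContinuousLinearMap.fst ℝ ℝ E').prod
        (((ContinuousLinearMap.fst ℝ E ℝ).comp (F'.comp (ContinuousLinearMap.snd ℝ ℝ E'))).prod
          (-(F x.2).2 • (ContinuousLinearMap.snd ℝ E ℝ).comp
            (F'.comp (ContinuousLinearMap.snd ℝ ℝ E'))))) x := by
  have h1 : HasFDerivAt (fun x : ℝ × E' ↦ F x.2) (F'.comp (ContinuousLinearMap.snd ℝ ℝ E')) x :=
    hF.comp x hasFDerivAt_snd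
  refine hasFDerivAt_fst.prodMk (h1.fst.prodMk ?_)
  have h2 := (h1.snd.pow 2).neg.mul_const (2⁻¹ : ℝ)
  simp only [← div_eq_mul_inv] at h2
  refine h2.congr_fderiv ?_
  ext <;> simp
  ring

lemma fderiv_cone_apply (hF : ContDiffAt ℝ 1 F y₀)
    (hG : G =ᶠ[nhds (t₀, y₀)] fun x ↦ (x.1, (F x.2).1, -(F x.2).2 ^ 2 / 2)) (b : ℝ × E') :
    fderiv ℝ G (t₀, y₀) b =
      (b.1, (fderiv ℝ F y₀ b.2).1, -(F y₀).2 * (fderiv ℝ F y₀ b.2).2) := by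
  rw [hG.fderiv_eq, (HasFDerivAt.cone (x := (t₀, y₀))
    (hF.differentiableAt one_ne_zero).hasFDerivAt).fderiv]
  rfl

lemma contDiffAt_cone {n : ℕ∞ω} (hF : ContDiffAt ℝ n F y₀)
    (hG : G =ᶠ[nhds (t₀, y₀)] fun x ↦ (x.1, (F x.2).1, -(F x.2).2 ^ 2 / 2)) :
    ContDiffAt ℝ n G (t₀, y₀) := by
  refine ContDiffAt.congr_of_eventuallyEq ?_ hG
  have h1 : ContDiffAt ℝ n (fun x : ℝ × E' ↦ F x.2) (t₀, y₀) :=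
    ContDiffAt.comp (t₀, y₀) hF contDiffAt_snd
  have h2 := h1.fst
  have h3 := h1.snd
  exact contDiffAt_fst.prodMk (h2.prodMk ((h3.pow 2).neg.div_const 2))

lemma fderiv_fderiv_cone_apply (hF : ContDiffAt ℝ 2 F y₀)
    (hG : G =ᶠ[nhds (t₀, y₀)] fun x ↦ (x.1, (F x.2).1, -(F x.2).2 ^ 2 / 2)) (a b : ℝ × E') :
    fderiv ℝ (fderiv ℝ G) (t₀, y₀) a b =
      (0, (fderiv ℝ (fderiv ℝ F) y₀ a.2 b.2).1,
        -((fderiv ℝ F y₀ a.2).2 * (fderiv ℝ F y₀ b.2).2) -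
          (F y₀).2 * (fderiv ℝ (fderiv ℝ F) y₀ a.2 b.2).2) := by
  have hG2 := ((contDiffAt_cone hF hG).fderiv_right (m := 1) (by norm_num)).differentiableAt
    one_ne_zero
  have hF2 := (hF.fderiv_right (m := 1) (by norm_num)).differentiableAt one_ne_zero
  have hF1 : ContDiffAt ℝ 1 F y₀ := hF.of_le (by norm_num)
  have hev : ∀ᶠ x in nhds ((t₀, y₀) : ℝ × E'), fderiv ℝ G x b =
      (b.1, (fderiv ℝ F x.2 b.2).1, -(F x.2).2 * (fderiv ℝ F x.2 b.2).2) := by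
    have h2 : ∀ᶠ y in nhds y₀, ContDiffAt ℝ 1 F y := hF1.eventually (by simp)
    filter_upwards [hG.eventuallyEq_nhds, (continuous_snd.tendsto (t₀, y₀)).eventually h2]
      with x hx hx'
    exact fderiv_cone_apply hx' hx b
  have hc : HasDerivAt (fun s : ℝ ↦ y₀ + s • a.2) a.2 0 := by
    simpa using ((hasDerivAt_id (0 : ℝ)).smul_const a.2).const_add y₀
  have h3 : HasDerivAt (fun s : ℝ ↦ F (y₀ + s • a.2)) (fderiv ℝ F y₀ a.2) 0 :=
    HasFDerivAt.comp_hasDerivAt (f := fun s : ℝ ↦ y₀ + s • a.2) 0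
      (by simpa using (hF1.differentiableAt one_ne_zero).hasFDerivAt) hc
  have h4 : HasDerivAt (fun s : ℝ ↦ fderiv ℝ F (y₀ + s • a.2) b.2)
      (fderiv ℝ (fderiv ℝ F) y₀ a.2 b.2) 0 := by
    have : HasDerivAt (fun s : ℝ ↦ fderiv ℝ F (y₀ + s • a.2)) (fderiv ℝ (fderiv ℝ F) y₀ a.2) 0 :=
      HasFDerivAt.comp_hasDerivAt (f := fun s : ℝ ↦ y₀ + s • a.2) 0
        (by simpa using hF2.hasFDerivAt) hc
    simpa using this.clm_apply (hasDerivAt_const 0 b.2)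
  have h5 : HasDerivAt (fun s : ℝ ↦ (b.1, (fderiv ℝ F (y₀ + s • a.2) b.2).1,
      -(F (y₀ + s • a.2)).2 * (fderiv ℝ F (y₀ + s • a.2) b.2).2))
      (0, (fderiv ℝ (fderiv ℝ F) y₀ a.2 b.2).1,
        -((fderiv ℝ F y₀ a.2).2 * (fderiv ℝ F y₀ b.2).2) -
          (F y₀).2 * (fderiv ℝ (fderiv ℝ F) y₀ a.2 b.2).2) 0 := by
    have h3s := (ContinuousLinearMap.snd ℝ E ℝ).hasFDerivAt.comp_hasDerivAt 0 h3
    have h4s := (ContinuousLinearMap.snd ℝ E ℝ).hasFDerivAt.comp_hasDerivAt 0 h4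
    have h4f := (ContinuousLinearMap.fst ℝ E ℝ).hasFDerivAt.comp_hasDerivAt 0 h4
    refine (hasDerivAt_const 0 b.1).prodMk (h4f.prodMk ((h3s.neg.mul h4s).congr_deriv ?_))
    simp
    ring
  have h6 := ((hG2.hasFDerivAt.clm_apply (hasFDerivAt_const b _)).congr_of_eventuallyEq
    (Filter.EventuallyEq.symm hev)).hasLineDerivAt a
  simpa using HasDerivAt.unique h6 h5

end Calculus

section Maps

variable {E : Type*} [NormedAddCommGroup E] [NormedSpace ℝ E] [FiniteDimensional ℝ E]
  {H : Type*} [TopologicalSpace H] {I : ModelWithCorners ℝ E H}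
  {M : Type*} [TopologicalSpace M] [ChartedSpace H M]
  {E' : Type*} [NormedAddCommGroup E'] [NormedSpace ℝ E'] [FiniteDimensional ℝ E']
  {H' : Type*} [TopologicalSpace H'] {J : ModelWithCorners ℝ E' H'} [J.Boundaryless]
  {S : Type*} [TopologicalSpace S] [ChartedSpace H' S]

omit [FiniteDimensional ℝ E] [FiniteDimensional ℝ E'] in
lemma differential_eq_fderiv {f : S → M} {q : S} (hf : MDifferentiableAt J I f q) :
    differential I J f q = fderiv ℝ (writtenInExtChartAt J I q f) (extChartAt J q q) := by
  rw [differential, hf.mfderiv, J.range_eq_univ, fderivWithin_univ]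

omit [FiniteDimensional ℝ E] [FiniteDimensional ℝ E'] in
lemma ContMDiffAt.contDiffAt_writtenInExtChartAt {f : S → M} {q : S} {n : ℕ∞ω}
    (hf : ContMDiffAt J I n f q) :
    ContDiffAt ℝ n (writtenInExtChartAt J I q f) (extChartAt J q q) := by
  have := (contMDiffAt_iff.1 hf).2
  rwa [J.range_eq_univ, contDiffWithinAt_univ] at this

variable {ε₀ ε : ℝ} (hε : ε₀ ^ 2 ≤ 2 * ε)

omit [FiniteDimensional ℝ E] [FiniteDimensional ℝ E'] [J.Boundaryless] in
lemma writtenInExtChartAt_homogeneousLift (f : S → PoincareSpace M ε₀) (t : posHalfLine) (q : S) :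
    writtenInExtChartAt (𝓘(ℝ, ℝ).prod J) (𝓘(ℝ, ℝ).prod (I.prod 𝓘(ℝ, ℝ))) (t, q)
      (homogeneousLift hε f) =ᶠ[nhds ((t : ℝ), extChartAt J q q)]
    fun x ↦ (x.1, (writtenInExtChartAt J (I.prod 𝓘(ℝ, ℝ)) q f x.2).1,
      -(writtenInExtChartAt J (I.prod 𝓘(ℝ, ℝ)) q f x.2).2 ^ 2 / 2) := by
  filter_upwards [(continuous_fst.tendsto ((t : ℝ), extChartAt J q q)).eventually
    (posHalfLine.isOpen.mem_nhds t.2)] with x hx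
  exact congrArg (fun s : ℝ ↦ (s, _)) (coe_extChartAt_opens_symm t hx)

omit [FiniteDimensional ℝ E] [FiniteDimensional ℝ E'] in
lemma mdifferentiableAt_homogeneousLift {f : S → PoincareSpace M ε₀} {q : S}
    (hc : Continuous f) (hf : ContMDiffAt J (I.prod 𝓘(ℝ, ℝ)) 1 f q) (t : posHalfLine) :
    MDifferentiableAt (𝓘(ℝ, ℝ).prod J) (𝓘(ℝ, ℝ).prod (I.prod 𝓘(ℝ, ℝ)))
      (homogeneousLift hε f) (t, q) := by
  have h1 : Continuous (homogeneousLift hε f) := by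
    unfold homogeneousLift
    fun_prop
  exact mdifferentiableAt_iff _ _ |>.2 ⟨h1.continuousAt, ((contDiffAt_cone hf.contDiffAt_writtenInExtChartAt
    (writtenInExtChartAt_homogeneousLift hε f t q)).differentiableAt
      one_ne_zero).differentiableWithinAt⟩

omit [FiniteDimensional ℝ E] [FiniteDimensional ℝ E'] in
lemma differential_homogeneousLift {f : S → PoincareSpace M ε₀} {q : S}
    (hc : Continuous f) (hf : ContMDiffAt J (I.prod 𝓘(ℝ, ℝ)) 1 f q) (t : posHalfLine)
    (a : ℝ × E') :
    differential (𝓘(ℝ, ℝ).prod (I.prod 𝓘(ℝ, ℝ))) (𝓘(ℝ, ℝ).prod J) (homogeneousLift hε f) (t, q) a =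
      (a.1, (differential (I.prod 𝓘(ℝ, ℝ)) J f q a.2).1,
        -((f q).2 : ℝ) * (differential (I.prod 𝓘(ℝ, ℝ)) J f q a.2).2) := by
  rw [differential_eq_fderiv (mdifferentiableAt_homogeneousLift hε hc hf t),
    differential_eq_fderiv (hf.mdifferentiableAt one_ne_zero)]
  have := fderiv_cone_apply hf.contDiffAt_writtenInExtChartAt
    (writtenInExtChartAt_homogeneousLift hε f t q) a
  have h0 : (writtenInExtChartAt J (I.prod 𝓘(ℝ, ℝ)) q f (extChartAt J q q)).2 = ((f q).2 : ℝ) := by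
    simp only [writtenInExtChartAt, Function.comp_apply, extChartAt_to_inv]
    rfl
  rw [h0] at this
  exact this

omit [FiniteDimensional ℝ E] [FiniteDimensional ℝ E'] in
lemma fderiv_fderiv_homogeneousLift {f : S → PoincareSpace M ε₀} {q : S}
    (hf : ContMDiffAt J (I.prod 𝓘(ℝ, ℝ)) 2 f q) (t : posHalfLine) (a b : ℝ × E') :
    fderiv ℝ (fderiv ℝ (writtenInExtChartAt (𝓘(ℝ, ℝ).prod J) (𝓘(ℝ, ℝ).prod (I.prod 𝓘(ℝ, ℝ))) (t, q)
      (homogeneousLift hε f))) (extChartAt (𝓘(ℝ, ℝ).prod J) (t, q) (t, q)) a b =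
    (0, (fderiv ℝ (fderiv ℝ (writtenInExtChartAt J (I.prod 𝓘(ℝ, ℝ)) q f))
        (extChartAt J q q) a.2 b.2).1,
      -((differential (I.prod 𝓘(ℝ, ℝ)) J f q a.2).2 *
        (differential (I.prod 𝓘(ℝ, ℝ)) J f q b.2).2) -
      ((f q).2 : ℝ) * (fderiv ℝ (fderiv ℝ (writtenInExtChartAt J (I.prod 𝓘(ℝ, ℝ)) q f))
        (extChartAt J q q) a.2 b.2).2) := by
  rw [differential_eq_fderiv (hf.mdifferentiableAt two_ne_zero)]
  have := fderiv_fderiv_cone_apply hf.contDiffAt_writtenInExtChartAt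
    (writtenInExtChartAt_homogeneousLift hε f t q) a b
  have h0 : (writtenInExtChartAt J (I.prod 𝓘(ℝ, ℝ)) q f (extChartAt J q q)).2 = ((f q).2 : ℝ) := by
    simp only [writtenInExtChartAt, Function.comp_apply, extChartAt_to_inv]
    rfl
  rw [h0] at this
  exact this

end Maps

section Minimal

variable {E : Type*} [NormedAddCommGroup E] [NormedSpace ℝ E] [FiniteDimensional ℝ E]
  {H : Type*} [TopologicalSpace H] {I : ModelWithCorners ℝ E H} [I.Boundaryless]
  {M : Type*} [TopologicalSpace M] [ChartedSpace H M]
  {E' : Type*} [NormedAddCommGroup E'] [NormedSpace ℝ E'] [FiniteDimensional ℝ E']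
  {H' : Type*} [TopologicalSpace H'] {J : ModelWithCorners ℝ E' H'} [J.Boundaryless]
  {S : Type*} [TopologicalSpace S] [ChartedSpace H' S]
  {γ : ℝ → BilinField I M} {ε ε₀ : ℝ}

/-- The identification of `ℝ × T(M × (0, ε₀))` with the tangent space of the ambient space, i.e.
the differential of `(t, p, r) ↦ (t, p, -r² / 2)`. -/
noncomputable def ambientEquiv (E : Type*) [NormedAddCommGroup E] [NormedSpace ℝ E] {r : ℝ} (hr : r ≠ 0) :
    (ℝ × E × ℝ) ≃ₗ[ℝ] (ℝ × E × ℝ) where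
  toFun x := (x.1, x.2.1, -r * x.2.2)
  map_add' x y := by ext <;> simp; ring
  map_smul' c x := by ext <;> simp; ring
  invFun x := (x.1, x.2.1, -r⁻¹ * x.2.2)
  left_inv x := by ext <;> simp [hr]
  right_inv x := by ext <;> simp [hr]

omit [FiniteDimensional ℝ E] in
lemma ambientEquiv_apply {r : ℝ} (hr : r ≠ 0) (x : ℝ × E × ℝ) :
    ambientEquiv E hr x = (x.1, x.2.1, -r * x.2.2) := rfl

/-- The linear form `(t / r) dr`. -/
noncomputable def scaledDr (E : Type*) [NormedAddCommGroup E] [NormedSpace ℝ E] (t r : ℝ) :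
    (E × ℝ) →ₗ[ℝ] ℝ := (t / r) • LinearMap.snd ℝ E ℝ

omit [FiniteDimensional ℝ E] in
lemma scaledDr_apply (t r : ℝ) (x : E × ℝ) : scaledDr E t r x = t / r * x.2 := rfl

omit [FiniteDimensional ℝ E] [I.Boundaryless] in
lemma poincareMetric_nondegenerate {x : PoincareSpace M ε₀}
    (h : (formAt I (γ (-(x.2 : ℝ) ^ 2 / 2)) x.1).Nondegenerate) :
    (formAt (I.prod 𝓘(ℝ, ℝ)) (poincareMetric I ε₀ γ) x).Nondegenerate := by
  have hr : ((x.2 : ℝ) ^ 2)⁻¹ ≠ 0 := inv_ne_zero (pow_ne_zero _ x.2.2.1.ne')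
  constructor
  · intro u hu
    have h1 : u.1 = 0 := h.1 _ fun v ↦ by
      have := hu (v, 0)
      rw [formAt_poincareMetric] at this
      simpa [hr] using this
    have h2 : u.2 = 0 := by
      have := hu (0, 1)
      rw [formAt_poincareMetric] at this
      simpa [hr] using this
    exact Prod.ext h1 h2
  · intro u hu
    have h1 : u.1 = 0 := h.2 _ fun v ↦ by
      have := hu (v, 0)
      rw [formAt_poincareMetric] at this
      simpa [hr] using this
    have h2 : u.2 = 0 := by
      have := hu (0, 1)
      rw [formAt_poincareMetric] at this
      simpa [hr] using this
    exact Prod.ext h1 h2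

variable (hε : ε₀ ^ 2 ≤ 2 * ε) {f : S → PoincareSpace M ε₀} {q : S} (t : posHalfLine)

omit [FiniteDimensional ℝ E] [I.Boundaryless] [FiniteDimensional ℝ E'] [TopologicalSpace S]
  [ChartedSpace H' S] [J.Boundaryless] in
/-- The cone structure `g̃ = -r² τ ⊗ τ + t² r² g₊`, where `τ = dt + (t / r) dr`. -/
lemma ambientMetric_ambientEquiv (hr : ((f q).2 : ℝ) ≠ 0) (x y : ℝ × E × ℝ) :
    formAt (𝓘(ℝ, ℝ).prod (I.prod 𝓘(ℝ, ℝ))) (ambientMetric I ε γ) (homogeneousLift hε f (t, q))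
      (ambientEquiv E hr x) (ambientEquiv E hr y) =
    -((f q).2 : ℝ) ^ 2 * (x.1 + scaledDr E t (f q).2 x.2) * (y.1 + scaledDr E t (f q).2 y.2) +
      ((t : ℝ) ^ 2 * ((f q).2 : ℝ) ^ 2) *
        formAt (I.prod 𝓘(ℝ, ℝ)) (poincareMetric I ε₀ γ) (f q) x.2 y.2 := by
  rw [formAt_ambientMetric, formAt_poincareMetric]
  simp only [ambientEquiv_apply, scaledDr_apply, homogeneousLift]
  field_simp
  ring

omit [FiniteDimensional ℝ E] [I.Boundaryless] [FiniteDimensional ℝ E'] in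
lemma inducedForm_homogeneousLift (hc : Continuous f)
    (hf : ContMDiffAt J (I.prod 𝓘(ℝ, ℝ)) 1 f q) (x y : ℝ × E') :
    inducedForm (𝓘(ℝ, ℝ).prod (I.prod 𝓘(ℝ, ℝ))) (𝓘(ℝ, ℝ).prod J) (ambientMetric I ε γ)
      (homogeneousLift hε f) (t, q) x y =
    -((f q).2 : ℝ) ^ 2 *
      (x.1 + (scaledDr E t (f q).2 ∘ₗ
        (differential (I.prod 𝓘(ℝ, ℝ)) J f q : E' →ₗ[ℝ] E × ℝ)) x.2) *
      (y.1 + (scaledDr E t (f q).2 ∘ₗ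
        (differential (I.prod 𝓘(ℝ, ℝ)) J f q : E' →ₗ[ℝ] E × ℝ)) y.2) +
      ((t : ℝ) ^ 2 * ((f q).2 : ℝ) ^ 2) *
        inducedForm (I.prod 𝓘(ℝ, ℝ)) J (poincareMetric I ε₀ γ) f q x.2 y.2 := by
  have hr : ((f q).2 : ℝ) ≠ 0 := (f q).2.2.1.ne'
  have h := ambientMetric_ambientEquiv (γ := γ) hε t hr
    (x.1, differential (I.prod 𝓘(ℝ, ℝ)) J f q x.2) (y.1, differential (I.prod 𝓘(ℝ, ℝ)) J f q y.2)
  have hd (x) : differential (𝓘(ℝ, ℝ).prod (I.prod 𝓘(ℝ, ℝ))) (𝓘(ℝ, ℝ).prod J)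
      (homogeneousLift hε f) (t, q) x =
      ambientEquiv E hr (x.1, differential (I.prod 𝓘(ℝ, ℝ)) J f q x.2) := by
    rw [differential_homogeneousLift hε hc hf]
    rfl
  rw [← hd, ← hd] at h
  exact h

variable [IsManifold I ∞ M]

/-- The rays of the cone are geodesics. -/
lemma covariantHessian_homogeneousLift_ray (hγ : IsSmoothMetricFamily I ε γ) (hc : Continuous f)
    (hf : ContMDiffAt J (I.prod 𝓘(ℝ, ℝ)) 2 f q)
    (hg : (formAt (𝓘(ℝ, ℝ).prod (I.prod 𝓘(ℝ, ℝ))) (ambientMetric I ε γ)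
      (homogeneousLift hε f (t, q))).Nondegenerate) :
    covariantHessian (𝓘(ℝ, ℝ).prod (I.prod 𝓘(ℝ, ℝ))) (𝓘(ℝ, ℝ).prod J) (ambientMetric I ε γ)
      (homogeneousLift hε f) (t, q) (1, 0) (1, 0) = 0 := by
  refine hg.1 _ fun w ↦ ?_
  rw [formAt_covariantHessian _ _ hg, fderiv_fderiv_homogeneousLift hε hf,
    differential_homogeneousLift hε hc (hf.of_le one_le_two)]
  simp only [hγ.metricDeriv_ambientMetric, formAt_ambientMetric, map_zero, Prod.fst_zero,
    Prod.snd_zero, LinearMap.zero_apply, zero_apply]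
  ring

omit [FiniteDimensional ℝ E'] in
lemma formAt_covariantHessian_homogeneousLift (hγ : IsSmoothMetricFamily I ε γ)
    (hc : Continuous f) (hf : ContMDiffAt J (I.prod 𝓘(ℝ, ℝ)) 2 f q)
    (hg : (formAt (𝓘(ℝ, ℝ).prod (I.prod 𝓘(ℝ, ℝ))) (ambientMetric I ε γ)
      (homogeneousLift hε f (t, q))).Nondegenerate)
    (hg' : (formAt (I.prod 𝓘(ℝ, ℝ)) (poincareMetric I ε₀ γ) (f q)).Nondegenerate)
    (hr : ((f q).2 : ℝ) ≠ 0) (a b : E') (w : E × ℝ) :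
    formAt (𝓘(ℝ, ℝ).prod (I.prod 𝓘(ℝ, ℝ))) (ambientMetric I ε γ) (homogeneousLift hε f (t, q))
      (covariantHessian (𝓘(ℝ, ℝ).prod (I.prod 𝓘(ℝ, ℝ))) (𝓘(ℝ, ℝ).prod J) (ambientMetric I ε γ)
        (homogeneousLift hε f) (t, q)
        (-scaledDr E t (f q).2 (differential (I.prod 𝓘(ℝ, ℝ)) J f q a), a)
        (-scaledDr E t (f q).2 (differential (I.prod 𝓘(ℝ, ℝ)) J f q b), b))
      (ambientEquiv E hr (-scaledDr E t (f q).2 w, w)) =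
    ((t : ℝ) ^ 2 * ((f q).2 : ℝ) ^ 2) *
      formAt (I.prod 𝓘(ℝ, ℝ)) (poincareMetric I ε₀ γ) (f q)
        (covariantHessian (I.prod 𝓘(ℝ, ℝ)) J (poincareMetric I ε₀ γ) f q a b) w := by
  rw [formAt_covariantHessian _ _ hg, formAt_covariantHessian _ _ hg',
    fderiv_fderiv_homogeneousLift hε hf,
    differential_homogeneousLift hε hc (hf.of_le one_le_two),
    differential_homogeneousLift hε hc (hf.of_le one_le_two)]
  simp only [hγ.metricDeriv_ambientMetric, hγ.metricDeriv_poincareMetric hε, formAt_ambientMetric,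
    formAt_poincareMetric, ambientEquiv_apply, scaledDr_apply, homogeneousLift]
  field_simp
  ring

/-- A submanifold is minimal iff its homogeneous lift is. -/
theorem isMinimal_iff_isMinimal_homogeneousLift [Nontrivial E']
    (hγ : IsSmoothMetricFamily I ε γ) (hf : ContMDiff J (I.prod 𝓘(ℝ, ℝ)) 2 f) :
    IsMinimal (I.prod 𝓘(ℝ, ℝ)) J (poincareMetric I ε₀ γ) f ↔
      IsMinimal (𝓘(ℝ, ℝ).prod (I.prod 𝓘(ℝ, ℝ))) (𝓘(ℝ, ℝ).prod J) (ambientMetric I ε γ)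
        (homogeneousLift hε f) := by
  have hc := hf.continuous
  have hr (q) : ((f q).2 : ℝ) ≠ 0 := (f q).2.2.1.ne'
  have h2 (q) : -((f q).2 : ℝ) ^ 2 ≠ 0 := neg_ne_zero.2 (pow_ne_zero 2 (hr q))
  have hm (t : posHalfLine) (q) : (t : ℝ) ^ 2 * ((f q).2 : ℝ) ^ 2 ≠ 0 :=
    mul_ne_zero (pow_ne_zero 2 (ne_of_gt t.2)) (pow_ne_zero 2 (hr q))
  have hind (t q) := inducedForm_homogeneousLift (γ := γ) hε t hc
    ((hf q).of_le one_le_two)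
  have hnd (t q) := nondegenerate_prod_iff (h2 q) (hm t q) (hind t q)
  have hg' (q) : (formAt (I.prod 𝓘(ℝ, ℝ)) (poincareMetric I ε₀ γ) (f q)).Nondegenerate :=
    poincareMetric_nondegenerate (hγ.nondegenerate _ (neg_sq_div_two_mem hε (f q).2.2) _)
  have hg (t q) : (formAt (𝓘(ℝ, ℝ).prod (I.prod 𝓘(ℝ, ℝ))) (ambientMetric I ε γ)
      (homogeneousLift hε f (t, q))).Nondegenerate :=
    (nondegenerate_compl₁₂_iff _ (ambientEquiv E (hr q))).1
      ((nondegenerate_prod_iff (h2 q) (hm t q)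
        (ambientMetric_ambientEquiv (γ := γ) hε t (hr q))).2 (hg' q))
  have hcurv (t q) (h : (inducedForm (I.prod 𝓘(ℝ, ℝ)) J (poincareMetric I ε₀ γ) f q).Nondegenerate) :
      meanCurvature (𝓘(ℝ, ℝ).prod (I.prod 𝓘(ℝ, ℝ))) (𝓘(ℝ, ℝ).prod J) (ambientMetric I ε γ)
        (homogeneousLift hε f) (t, q) = 0 ↔
      meanCurvature (I.prod 𝓘(ℝ, ℝ)) J (poincareMetric I ε₀ γ) f q = 0 := by
    rw [meanCurvature_eq_zero_iff _ _ h, meanCurvature_eq_zero_iff _ _ ((hnd t q).2 h)]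
    refine mem_range_cone_iff (hg' q) (hm t q) (ambientMetric_ambientEquiv (γ := γ) hε t (hr q))
      (map_smul _) (fun x ↦ ?_) fun w ↦ ?_
    · rw [differential_homogeneousLift hε hc ((hf q).of_le one_le_two)]
      rfl
    · have h3 := metricTrace_prod (h2 q) (hm t q) (hind t q) h
        (covariantHessianBilin (𝓘(ℝ, ℝ).prod (I.prod 𝓘(ℝ, ℝ))) (𝓘(ℝ, ℝ).prod J) (hg t q))
      simp only [covariantHessianBilin_apply,
        covariantHessian_homogeneousLift_ray hε t hγ hc (hf q) (hg t q), smul_zero, zero_add] at h3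
      have h4 := metricTrace_map (inducedForm (I.prod 𝓘(ℝ, ℝ)) J (poincareMetric I ε₀ γ) f q)
        (covariantHessian (I.prod 𝓘(ℝ, ℝ)) J (poincareMetric I ε₀ γ) f q)
        ((formAt (I.prod 𝓘(ℝ, ℝ)) (poincareMetric I ε₀ γ) (f q)).flip w)
      have h5 := metricTrace_map (inducedForm (I.prod 𝓘(ℝ, ℝ)) J (poincareMetric I ε₀ γ) f q)
        (fun a b ↦ covariantHessian (𝓘(ℝ, ℝ).prod (I.prod 𝓘(ℝ, ℝ))) (𝓘(ℝ, ℝ).prod J)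
          (ambientMetric I ε γ) (homogeneousLift hε f) (t, q)
          (-scaledDr E t (f q).2 (differential (I.prod 𝓘(ℝ, ℝ)) J f q a), a)
          (-scaledDr E t (f q).2 (differential (I.prod 𝓘(ℝ, ℝ)) J f q b), b))
        ((formAt (𝓘(ℝ, ℝ).prod (I.prod 𝓘(ℝ, ℝ))) (ambientMetric I ε γ)
          (homogeneousLift hε f (t, q))).flip
            (ambientEquiv E (hr q) (-scaledDr E t (f q).2 w, w)))
      have h6 (c : ℝ) (L : E' → E' → ℝ) (B : LinearMap.BilinForm ℝ E') :
          metricTrace B (fun a b ↦ c * L a b) = c * metricTrace B L :=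
        metricTrace_map B L (c • LinearMap.id)
      have h7 := (congrArg (metricTrace _) (funext₂ fun a b ↦
        formAt_covariantHessian_homogeneousLift hε t hγ hc (hf q) (hg t q) (hg' q) (hr q)
          a b w)).symm.trans h5
      rw [h6] at h7
      refine (congrArg (fun z ↦ formAt (𝓘(ℝ, ℝ).prod (I.prod 𝓘(ℝ, ℝ))) (ambientMetric I ε γ)
        (homogeneousLift hε f (t, q)) z
          (ambientEquiv E (hr q) (-scaledDr E t (f q).2 w, w))) h3).trans ?_
      refine (LinearMap.map_smul₂ _ _ _ _).trans ?_
      refine (congrArg (_ • ·) h7.symm).trans ?_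
      rw [smul_eq_mul, inv_mul_cancel_left₀ (hm t q)]
      exact h4
  constructor
  · rintro ⟨h, h'⟩
    exact ⟨fun ⟨t, q⟩ ↦ (hnd t q).2 (h q), fun ⟨t, q⟩ ↦ (hcurv t q (h q)).2 (h' q)⟩
  · rintro ⟨h, h'⟩
    let t₁ : posHalfLine := ⟨1, zero_lt_one (α := ℝ)⟩
    have h1 (q) := (hnd t₁ q).1 (h _)
    exact ⟨h1, fun q ↦ (hcurv t₁ q (h1 q)).1 (h' _)⟩

end Minimal

theorem proposition6 {n k : ℕ} (hn : 2 ≤ n) (hk : 1 ≤ k) (hkn : k ≤ n)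
    {M : Type*} [TopologicalSpace M] [T2Space M] [SecondCountableTopology M]
    [ChartedSpace (EuclideanSpace ℝ (Fin n)) M] [IsManifold (𝓡 n) ∞ M]
    {ε₀ ε : ℝ} (hε₀ : 0 < ε₀) (hε : ε₀ ^ 2 ≤ 2 * ε)
    (γ : ℝ → BilinField (𝓡 n) M) (hγ : IsSmoothMetricFamily (𝓡 n) ε γ)
    {Y : Type*} [TopologicalSpace Y]
    [ChartedSpace (EuclideanSpace ℝ (Fin k)) Y] [IsManifold (𝓡 k) ∞ Y]
    (f : Y → PoincareSpace M ε₀)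
    (hf : Manifold.IsSmoothEmbedding (𝓡 k) ((𝓡 n).prod 𝓘(ℝ, ℝ)) ∞ f) :
    IsMinimal ((𝓡 n).prod 𝓘(ℝ, ℝ)) (𝓡 k) (poincareMetric (𝓡 n) ε₀ γ) f ↔
      IsMinimal (𝓘(ℝ, ℝ).prod ((𝓡 n).prod 𝓘(ℝ, ℝ))) (𝓘(ℝ, ℝ).prod (𝓡 k))
        (ambientMetric (𝓡 n) ε γ) (homogeneousLift hε f) := by
  have : Nonempty (Fin k) := ⟨⟨0, hk⟩⟩
  exact isMinimal_iff_isMinimal_homogeneousLift hε hγ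
    (hf.contMDiff.of_le (WithTop.coe_le_coe.2 (le_top : (2 : ℕ∞) ≤ ⊤)))
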